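/- A permutation of length $n$ is a bijection $p = p_1p_2\cdots p_n$ of $\{1,\dots,n\}$. For a pattern $q = q_1q_2\cdots q_k$ (a permutation of length $k$), a copy of $q$ in $p$ is a choice of positions $i_1 < i_2 < \cdots < i_k$ such that, for all $a, b$, one has $p_{i_a} < p_{i_b}$ if and only if $q_a < q_b$. Let $S_n(q,1)$ denote the number of permutations of length $n$ that contain exactly one copy of $q$. Theorem. Let $k \geq 3$, let $k\cdots 21$ be the decreasing pattern of length $k$, and let $$s_{k\cdots 21,1}(z) = \sum_{n \geq 0} S_n(k\cdots 21,1)\, z^n$$ be the ordinary generating function of the sequence $S_n(k\cdots 21,1)$. Then $s_{k\cdots 21,1}(z)$ is not rational; that is, there are no polynomials $P, Q \in \mathbb{C}[z]$ with $Q \neq 0$ such that $Q(z)\, s_{k\cdots 21,1}(z) = P(z)$ as formal power series. -/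

import Mathlib

/-- The positions chosen by the increasing map `e` form a copy of the pattern `q` in the
permutation `p`: the entries of `p` in these positions are in the same relative order as the
entries of `q`. Distinct copies correspond to distinct maps `e`, because an increasing map from
`Fin k` is determined by its set of values. -/
def IsPatternCopy {k n : ℕ} (q : Equiv.Perm (Fin k)) (p : Equiv.Perm (Fin n))
    (e : Fin k ↪o Fin n) : Prop :=
  ∀ i j : Fin k, q i < q j ↔ p (e i) < p (e j)

/-- The set of permutations of length `n` that contain exactly one copy of the pattern `q`. -/
def permsWithOneCopy {k : ℕ} (q : Equiv.Perm (Fin k)) (n : ℕ) : Set (Equiv.Perm (Fin n)) :=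
  {p | ∃! e : Fin k ↪o Fin n, IsPatternCopy q p e}

/-- The number of permutations of length `n` that contain exactly one copy of the pattern `q`. -/
noncomputable def numPermsWithOneCopy {k : ℕ} (q : Equiv.Perm (Fin k)) (n : ℕ) : ℕ :=
  (permsWithOneCopy q n).ncard

/-- The decreasing pattern of length `k`, as a permutation of `Fin k` (entries shifted by one). -/
def decreasingPattern (k : ℕ) : Equiv.Perm (Fin k) :=
  Fin.revPerm

/-- The ordinary generating function of the numbers of permutations of length `n` with exactly one
copy of the pattern `q`, as a formal power series with complex coefficients. -/
noncomputable def oneCopyGenFun {k : ℕ} (q : Equiv.Perm (Fin k)) : PowerSeries ℂ :=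
  PowerSeries.mk fun n => (numPermsWithOneCopy q n : ℂ)

/-- A formal power series is rational if it is the quotient of two polynomials. -/
def IsRationalSeries {K : Type*} [Field K] (f : PowerSeries K) : Prop :=
  ∃ P Q : Polynomial K, Q ≠ 0 ∧ (Q : PowerSeries K) * f = (P : PowerSeries K)

/-!
Write `r = k - 1` and let `u n` be the number of permutations of length `n` with exactly one decreasing
subsequence of length `k`. The sequence `u n` has exponential growth rate exactly `r ^ 2`, but it is
`o((r ^ 2) ^ n)`. This is impossible for a rational generating function: a pole on the circle of
convergence contributes terms of full order `(r ^ 2) ^ n`, so its coefficients would be `O(ρ ^ n)` for some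
`ρ < r ^ 2` (`IsRationalSeries.geometric_bound`, proved by cancelling the linear factors of the
denominator one at a time).

Upper bound (`tendsto_numPermsWithOneCopy_div`). Delete the left-to-right maxima of a permutation with
exactly one decreasing subsequence of length `k + 1`. What is left has exactly one of length `k`, and it
determines the permutation together with the sets of its positions and values
(`ncard_fiber_nonRecords_le`). Hence `u` for `k + 1` is at most a sum over `N` of `C(n, N) ^ 2` times `u N`
for `k`, and smallness passes from `k` to `k + 1`. For `k = 3`, the positions and values are encoded
by the running maximum, a ballot sequence, and what is left is an adjacent transposition; so `u n` is at most
`n` times a Catalan number, which is `o(4 ^ n)`.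

Lower bound (`sq_le_of_numPermsWithOneCopy_le`). It suffices to find many permutations without a
decreasing subsequence of length `r + 1`, since the direct sum with a decreasing permutation of that length
creates exactly one. A pair of standard fillings of an `r × m` rectangle gives such a
permutation, and the pair can be recovered from it, because the row of an entry, counted from 1, is the
length of the longest decreasing subsequence ending there (`permOfFillings_injective`). Many standard fillings
arise by cutting the rectangle into diagonal regions, inside which only the order along rows matters
(`card_rowFilling_pow_le`); this gives powers of the multinomial coefficient `(r l)! / (l!) ^ r`, whose growth
rate per letter tends to `r`.
-/

open Filter Topology

/-! ### Coefficients of rational power series -/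

/-- One linear factor of a denominator can be cancelled: the coefficients `b (n + 1) = a n - ζ * a (n + 1)` of
`(X - ζ) * f` decay geometrically relative to `R ^ n`, and then so do the coefficients `a n` of `f`. -/
theorem geometric_bound_of_linear_factor {R : ℝ} (hR : 0 < R) (ζ : ℂ) (a b : ℕ → ℂ)
    (hab : ∀ n, b (n + 1) = a n - ζ * a (n + 1))
    (ha : Tendsto (fun n => ‖a n‖ / R ^ n) atTop (𝓝 0))
    {ρ C : ℝ} (hρ : 0 < ρ) (hρR : ρ < R) (hb : ∀ n, ‖b n‖ ≤ C * ρ ^ n) :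
    ∃ ρ' C' : ℝ, 0 < ρ' ∧ ρ' < R ∧ ∀ n, ‖a n‖ ≤ C' * ρ' ^ n := by
  have hC : 0 ≤ C := by simpa using (norm_nonneg _).trans (hb 0)
  rcases le_or_gt (‖ζ‖ * R) 1 with hζ | hζ
  · -- the recurrence is solved from infinity, using that `a n` is `o(R ^ n)`
    have hlt : 0 < 1 - ρ / R := by
      have : ρ / R < 1 := (div_lt_one hR).2 hρR
      linarith
    refine ⟨ρ, C * ρ / (1 - ρ / R), hρ, hρR, fun n => ?_⟩
    set C' := C * ρ / (1 - ρ / R) with hC'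
    have hC'eq : C' * (1 - ρ / R) = C * ρ := div_mul_cancel₀ _ hlt.ne'
    have hC'0 : 0 ≤ C' := by positivity
    have hζ' : ‖ζ‖ ≤ 1 / R := (le_div_iff₀ hR).2 hζ
    have step : ∀ n, ‖a n‖ - C' * ρ ^ n ≤ 1 / R * (‖a (n + 1)‖ - C' * ρ ^ (n + 1)) := by
      intro n
      have h1 : a n = b (n + 1) + ζ * a (n + 1) := by rw [hab]; ring
      have h2 : ‖a n‖ ≤ C * ρ ^ (n + 1) + 1 / R * ‖a (n + 1)‖ := by
        rw [h1]
        refine (norm_add_le _ _).trans (add_le_add (hb _) ?_)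
        rw [norm_mul]
        gcongr
      have h3 : C' * ρ ^ n - 1 / R * (C' * ρ ^ (n + 1)) = C * ρ ^ (n + 1) := by
        calc C' * ρ ^ n - 1 / R * (C' * ρ ^ (n + 1)) = C' * (1 - ρ / R) * ρ ^ n := by ring
          _ = C * ρ ^ (n + 1) := by rw [hC'eq]; ring
      linarith
    have iter : ∀ J, ‖a n‖ - C' * ρ ^ n ≤ (1 / R) ^ J * (‖a (n + J)‖ - C' * ρ ^ (n + J)) := by
      intro J
      induction J with
      | zero => simp
      | succ J ih =>
        refine ih.trans ?_
        rw [pow_succ, mul_assoc]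
        exact mul_le_mul_of_nonneg_left (step _) (by positivity)
    have bound : ∀ J, ‖a n‖ - C' * ρ ^ n ≤ R ^ n * (‖a (J + n)‖ / R ^ (J + n)) := by
      intro J
      refine (iter J).trans ?_
      have : R ^ n * (‖a (J + n)‖ / R ^ (J + n)) = (1 / R) ^ J * ‖a (n + J)‖ := by
        rw [add_comm J n, pow_add, one_div, inv_pow]
        field_simp
      rw [this]
      refine mul_le_mul_of_nonneg_left ?_ (by positivity)
      have : 0 ≤ C' * ρ ^ (n + J) := by positivity
      linarith
    have lim : Tendsto (fun J => R ^ n * (‖a (J + n)‖ / R ^ (J + n))) atTop (𝓝 (R ^ n * 0)) :=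
      ((tendsto_add_atTop_iff_nat n).2 ha).const_mul _
    have := ge_of_tendsto' lim bound
    linarith
  · -- the recurrence is solved forwards, with ratio `‖ζ‖⁻¹ < R`
    have hζ0 : 0 < ‖ζ‖ := by
      by_contra h
      have : ‖ζ‖ = 0 := le_antisymm (not_lt.1 h) (norm_nonneg _)
      rw [this] at hζ
      linarith
    have hζR : ‖ζ‖⁻¹ < R := by
      rw [inv_lt_iff_one_lt_mul₀ hζ0]
      linarith
    obtain ⟨σ, hσ1, hσR⟩ := exists_between (max_lt hζR hρR)
    have hσζ : ‖ζ‖⁻¹ < σ := (le_max_left _ _).trans_lt hσ1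
    have hσρ : ρ < σ := (le_max_right _ _).trans_lt hσ1
    have hσ : 0 < σ := hρ.trans hσρ
    have hd : 0 < σ - ‖ζ‖⁻¹ := sub_pos.2 hσζ
    set D := max ‖a 0‖ (C * ‖ζ‖⁻¹ * σ / (σ - ‖ζ‖⁻¹)) with hD
    refine ⟨σ, D, hσ, hσR, fun n => ?_⟩
    induction n with
    | zero => simp [hD]
    | succ n ih =>
      have hζne : ζ ≠ 0 := norm_pos_iff.1 hζ0
      have h1 : a (n + 1) = ζ⁻¹ * (a n - b (n + 1)) := by rw [hab]; field_simp; ring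
      have hb' : ‖b (n + 1)‖ ≤ C * σ ^ (n + 1) :=
        (hb _).trans (by gcongr)
      have h2 : ‖a (n + 1)‖ ≤ ‖ζ‖⁻¹ * (D * σ ^ n + C * σ ^ (n + 1)) := by
        rw [h1, norm_mul, norm_inv]
        gcongr
        exact (norm_sub_le _ _).trans (add_le_add ih hb')
      have h3 : C * ‖ζ‖⁻¹ * σ ≤ D * (σ - ‖ζ‖⁻¹) := (div_le_iff₀ hd).1 (le_max_right _ _)
      calc ‖a (n + 1)‖ ≤ ‖ζ‖⁻¹ * (D * σ ^ n + C * σ ^ (n + 1)) := h2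
        _ = (‖ζ‖⁻¹ * D + C * ‖ζ‖⁻¹ * σ) * σ ^ n := by ring
        _ ≤ (‖ζ‖⁻¹ * D + D * (σ - ‖ζ‖⁻¹)) * σ ^ n := by gcongr
        _ = D * σ ^ (n + 1) := by ring

open Polynomial in
/-- Geometric decay relative to `R ^ n` passes from `Q * f` to `f`, by induction on the degree of `Q`. The
right-hand side `g` is not assumed to be a polynomial, so that the induction hypothesis applies to
`(X - ζ) * f` when `Q = (X - ζ) * Q'`. -/
theorem geometric_bound_of_polynomial_mul {R : ℝ} (hR : 0 < R) (d : ℕ) :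
    ∀ (Q : ℂ[X]) (f g : PowerSeries ℂ), Q.natDegree = d → Q ≠ 0 → (Q : PowerSeries ℂ) * f = g →
      Tendsto (fun n => ‖PowerSeries.coeff n f‖ / R ^ n) atTop (𝓝 0) →
      (∃ ρ C : ℝ, 0 < ρ ∧ ρ < R ∧ ∀ n, ‖PowerSeries.coeff n g‖ ≤ C * ρ ^ n) →
      ∃ ρ C : ℝ, 0 < ρ ∧ ρ < R ∧ ∀ n, ‖PowerSeries.coeff n f‖ ≤ C * ρ ^ n := by
  induction d with
  | zero =>
    rintro Q f g hd hQ hfg - ⟨ρ, C, hρ, hρR, hg⟩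
    obtain ⟨c, rfl⟩ : ∃ c, Q = Polynomial.C c := ⟨_, eq_C_of_natDegree_eq_zero hd⟩
    have hc : c ≠ 0 := fun h => hQ (by simp [h])
    refine ⟨ρ, ‖c‖⁻¹ * C, hρ, hρR, fun n => ?_⟩
    have : PowerSeries.coeff n g = c * PowerSeries.coeff n f := by
      rw [← hfg, Polynomial.coe_C, PowerSeries.coeff_C_mul]
    have h2 : PowerSeries.coeff n f = c⁻¹ * PowerSeries.coeff n g := by
      rw [this]; field_simp
    rw [h2, norm_mul, norm_inv, mul_assoc]
    exact mul_le_mul_of_nonneg_left (hg n) (by positivity)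
  | succ d ih =>
    intro Q f g hd hQ hfg hf hg
    obtain ⟨ζ, hζ⟩ := IsAlgClosed.exists_root Q (by
      rw [degree_eq_natDegree hQ, hd]; exact_mod_cast Nat.succ_ne_zero d)
    obtain ⟨Q', rfl⟩ := dvd_iff_isRoot.2 hζ
    have hQ' : Q' ≠ 0 := right_ne_zero_of_mul hQ
    have hd' : Q'.natDegree = d := by
      rw [natDegree_mul (X_sub_C_ne_zero ζ) hQ', natDegree_X_sub_C] at hd
      omega
    set f₁ : PowerSeries ℂ := ((X - C ζ : ℂ[X]) : PowerSeries ℂ) * f with hf₁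
    have hcoeff : ∀ n, PowerSeries.coeff (n + 1) f₁ =
        PowerSeries.coeff n f - ζ * PowerSeries.coeff (n + 1) f := by
      intro n
      rw [hf₁, Polynomial.coe_sub, Polynomial.coe_X, Polynomial.coe_C, sub_mul, map_sub,
        PowerSeries.coeff_C_mul, PowerSeries.coeff_succ_X_mul]
    have hlim : Tendsto (fun n => ‖PowerSeries.coeff n f₁‖ / R ^ n) atTop (𝓝 0) := by
      rw [← tendsto_add_atTop_iff_nat 1]
      have hsum := (hf.const_mul (1 / R)).add
        (((tendsto_add_atTop_iff_nat 1).2 hf).const_mul ‖ζ‖)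
      rw [mul_zero, mul_zero, add_zero] at hsum
      refine squeeze_zero (fun n => by positivity) (fun n => ?_) hsum
      rw [hcoeff]
      calc ‖PowerSeries.coeff n f - ζ * PowerSeries.coeff (n + 1) f‖ / R ^ (n + 1)
          ≤ (‖PowerSeries.coeff n f‖ + ‖ζ‖ * ‖PowerSeries.coeff (n + 1) f‖) / R ^ (n + 1) := by
            gcongr
            exact (norm_sub_le _ _).trans_eq (by rw [norm_mul])
        _ = _ := by rw [pow_succ]; field_simp
    obtain ⟨ρ, C, hρ, hρR, hb⟩ := ih Q' f₁ g hd' hQ' (by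
      rw [← hfg, hf₁, Polynomial.coe_mul]; ring) hlim hg
    exact geometric_bound_of_linear_factor hR ζ _ _ hcoeff hf hρ hρR hb

/-- A rational power series whose coefficients are `o(R ^ n)` has all its poles outside the closed
disc of radius `1 / R`, hence its coefficients are even `O(ρ ^ n)` for some `ρ < R`. -/
theorem IsRationalSeries.geometric_bound {f : PowerSeries ℂ} (hf : IsRationalSeries f) {R : ℝ}
    (hR : 0 < R) (h : Tendsto (fun n => ‖PowerSeries.coeff n f‖ / R ^ n) atTop (𝓝 0)) :
    ∃ ρ C : ℝ, 0 < ρ ∧ ρ < R ∧ ∀ n, ‖PowerSeries.coeff n f‖ ≤ C * ρ ^ n := by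
  obtain ⟨P, Q, hQ, hPQ⟩ := hf
  refine geometric_bound_of_polynomial_mul hR _ Q f P rfl hQ hPQ h
    ⟨R / 2, ∑ i ∈ Finset.range (P.natDegree + 1), ‖P.coeff i‖ / (R / 2) ^ i, by positivity,
      by linarith, fun n => ?_⟩
  rw [Polynomial.coeff_coe]
  rcases le_or_gt n P.natDegree with hn | hn
  · rw [← div_le_iff₀ (by positivity)]
    exact Finset.single_le_sum (f := fun i => ‖P.coeff i‖ / (R / 2) ^ i)
      (fun i _ => by positivity) (Finset.mem_range.2 (by omega))
  · rw [Polynomial.coeff_eq_zero_of_natDegree_lt hn, norm_zero]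
    positivity

/-! ### Deleting the left-to-right maxima -/

/-- A permutation contains exactly one copy of the decreasing pattern of length `k` if and only if
it is strictly decreasing on exactly one `k`-tuple of positions. -/
theorem mem_permsWithOneCopy_decreasing {k n : ℕ} {p : Equiv.Perm (Fin n)} :
    p ∈ permsWithOneCopy (decreasingPattern k) n ↔
      ∃! e : Fin k ↪o Fin n, StrictAnti fun i => p (e i) := by
  have key : ∀ e : Fin k ↪o Fin n,
      IsPatternCopy (decreasingPattern k) p e ↔ StrictAnti fun i => p (e i) := by
    intro e
    have h0 : ∀ i j : Fin k, decreasingPattern k i < decreasingPattern k j ↔ j < i := fun i j => by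
      simp [decreasingPattern]
    simp only [IsPatternCopy, h0]
    constructor
    · intro h i j hij
      exact (h j i).1 hij
    · intro h i j
      exact h.lt_iff_gt.symm
  simp only [permsWithOneCopy, Set.mem_ofPred_eq, key]

/-- The positions of the entries of `p` that are not left-to-right maxima. -/
def nonRecords {n : ℕ} (p : Equiv.Perm (Fin n)) : Finset (Fin n) :=
  {i | ∃ j < i, p i < p j}

theorem mem_nonRecords {n : ℕ} {p : Equiv.Perm (Fin n)} {i : Fin n} :
    i ∈ nonRecords p ↔ ∃ j < i, p i < p j := by
  simp [nonRecords]

/-- The left-to-right maxima of a permutation are increasing, so the permutation is determined by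
its remaining entries. -/
theorem eq_of_nonRecords_eq {n : ℕ} {p p' : Equiv.Perm (Fin n)} {X Y : Finset (Fin n)}
    (hX : nonRecords p = X) (hX' : nonRecords p' = X) (hY : X.map p.toEmbedding = Y)
    (hY' : X.map p'.toEmbedding = Y) (h : ∀ i ∈ X, p i = p' i) : p = p' := by
  have key : ∀ q : Equiv.Perm (Fin n), nonRecords q = X → X.map q.toEmbedding = Y →
      ∀ hc : (Yᶜ).card = (Xᶜ).card, (fun i => q ((Xᶜ).orderEmbOfFin rfl i)) = (Yᶜ).orderEmbOfFin hc := by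
    intro q hq hqY hc
    apply Finset.orderEmbOfFin_unique
    · intro i
      have hi := Finset.orderEmbOfFin_mem (Xᶜ) rfl i
      rw [Finset.mem_compl] at hi ⊢
      rw [← hqY]
      simpa using hi
    · intro i j hij
      set x := (Xᶜ).orderEmbOfFin rfl i
      set y := (Xᶜ).orderEmbOfFin rfl j with hy
      have hxy : x < y := ((Xᶜ).orderEmbOfFin rfl).strictMono hij
      have hyX : y ∉ X := Finset.mem_compl.1 (Finset.orderEmbOfFin_mem (Xᶜ) rfl j)
      by_contra hlt
      refine hyX (hq ▸ mem_nonRecords.2 ⟨x, hxy, lt_of_le_of_ne (not_lt.1 hlt) ?_⟩)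
      exact fun h => hxy.ne' (q.injective h)
  have hc : (Yᶜ).card = (Xᶜ).card := by
    rw [Finset.card_compl, Finset.card_compl, ← hY, Finset.card_map]
  have hfun := (key p hX hY hc).trans (key p' hX' hY' hc).symm
  ext1 i
  by_cases hi : i ∈ X
  · exact h i hi
  · have : i ∈ Set.range ((Xᶜ).orderEmbOfFin rfl) := by
      rw [Finset.range_orderEmbOfFin]; simpa using hi
    obtain ⟨j, rfl⟩ := this
    exact congrFun hfun j

/-- If `p` has exactly one decreasing subsequence of length `k + 1`, the entries of `p` that are not
left-to-right maxima have exactly one of length `k`: every decreasing sequence of such entries is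
preceded by a larger entry. -/
theorem exists_pattern_of_nonRecords {k n : ℕ} (hk : 1 ≤ k) {p : Equiv.Perm (Fin n)}
    (hp : p ∈ permsWithOneCopy (decreasingPattern (k + 1)) n) {X Y : Finset (Fin n)}
    (hX : nonRecords p = X) (hY : X.map p.toEmbedding = Y) (hc : Y.card = X.card) :
    ∃ σ ∈ permsWithOneCopy (decreasingPattern k) X.card,
      ∀ i, p (X.orderEmbOfFin rfl i) = Y.orderEmbOfFin hc (σ i) := by
  have hXY : ∀ a, a ∈ X ↔ p a ∈ Y := fun a => by simp [← hY]
  let σ : Equiv.Perm (Fin X.card) := (X.orderIsoOfFin rfl).toEquiv.trans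
    ((p.subtypeEquiv hXY).trans (Y.orderIsoOfFin hc).symm.toEquiv)
  have hσ : ∀ i, p (X.orderEmbOfFin rfl i) = Y.orderEmbOfFin hc (σ i) := by
    intro i
    rw [← Finset.coe_orderIsoOfFin_apply, ← Finset.coe_orderIsoOfFin_apply]
    simp [σ]
  refine ⟨σ, ?_, hσ⟩
  rw [mem_permsWithOneCopy_decreasing] at hp ⊢
  obtain ⟨E, hE, huniq⟩ := hp
  have hσlt : ∀ i j, σ i < σ j ↔
      p (X.orderEmbOfFin rfl i) < p (X.orderEmbOfFin rfl j) := by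
    intro i j
    rw [hσ, hσ, OrderEmbedding.lt_iff_lt]
  have htail : ∀ i : Fin k, E i.succ ∈ Set.range (X.orderEmbOfFin rfl) := by
    intro i
    rw [Finset.range_orderEmbOfFin, Finset.mem_coe, ← hX, mem_nonRecords]
    exact ⟨E 0, E.strictMono (Fin.succ_pos i), hE (Fin.succ_pos i)⟩
  choose e he using htail
  have hemono : StrictMono e := by
    intro i j hij
    have := E.strictMono (Fin.succ_lt_succ_iff.2 hij)
    rwa [← he, ← he, OrderEmbedding.lt_iff_lt] at this
  -- a copy in `σ` extends to the copy `E` in `p`, so it is the tail of `E`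
  have hext : ∀ f : Fin k ↪o Fin X.card, (StrictAnti fun i => σ (f i)) →
      ∀ i, X.orderEmbOfFin rfl (f i) = E i.succ := by
    intro f hf
    obtain ⟨m, rfl⟩ : ∃ m, k = m + 1 := ⟨k - 1, by omega⟩
    have hx : X.orderEmbOfFin rfl (f 0) ∈ nonRecords p := by
      rw [hX]; exact Finset.orderEmbOfFin_mem _ _ _
    obtain ⟨j, hj, hpj⟩ := mem_nonRecords.1 hx
    let F : Fin (m + 1 + 1) → Fin n := Fin.cons j fun i => X.orderEmbOfFin rfl (f i)
    have hF : StrictMono F := by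
      rw [Fin.strictMono_iff_lt_succ]
      intro i
      refine Fin.cases ?_ (fun i => ?_) i
      · simpa [F] using hj
      · rw [← Fin.succ_castSucc]
        simp only [F, Fin.cons_succ, OrderEmbedding.lt_iff_lt]
        exact Fin.castSucc_lt_succ
    have hpF : StrictAnti fun i => p (F i) := by
      rw [Fin.strictAnti_iff_succ_lt]
      intro i
      refine Fin.cases ?_ (fun i => ?_) i
      · simpa [F] using hpj
      · rw [← Fin.succ_castSucc]
        simp only [F, Fin.cons_succ]
        exact (hσlt _ _).1 (hf Fin.castSucc_lt_succ)
    have hFE : OrderEmbedding.ofStrictMono F hF = E := huniq _ hpF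
    intro i
    rw [← hFE]
    simp [F]
  refine ⟨OrderEmbedding.ofStrictMono e hemono, ?_, ?_⟩
  · intro i j hij
    simp only [OrderEmbedding.coe_ofStrictMono]
    rw [hσlt, he, he]
    exact hE (Fin.succ_lt_succ_iff.2 hij)
  · intro f hf
    ext1 i
    apply (X.orderEmbOfFin rfl).injective
    rw [hext f hf]
    simp [he]

/-- The number of permutations with exactly one decreasing subsequence of length `k + 1` and
prescribed positions and values of the entries that are not left-to-right maxima. -/
theorem ncard_fiber_nonRecords_le {k n : ℕ} (hk : 1 ≤ k) (X Y : Finset (Fin n)) :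
    {p ∈ permsWithOneCopy (decreasingPattern (k + 1)) n |
      nonRecords p = X ∧ X.map p.toEmbedding = Y}.ncard ≤
      numPermsWithOneCopy (decreasingPattern k) X.card := by
  rcases Set.eq_empty_or_nonempty {p ∈ permsWithOneCopy (decreasingPattern (k + 1)) n |
      nonRecords p = X ∧ X.map p.toEmbedding = Y} with h | ⟨q, hq⟩
  · rw [h]; simp
  have hc : Y.card = X.card := by rw [← hq.2.2, Finset.card_map]
  have : ∀ p ∈ {p ∈ permsWithOneCopy (decreasingPattern (k + 1)) n |
      nonRecords p = X ∧ X.map p.toEmbedding = Y},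
      ∃ σ, σ ∈ permsWithOneCopy (decreasingPattern k) X.card ∧
      ∀ i, p (X.orderEmbOfFin rfl i) = Y.orderEmbOfFin hc (σ i) := fun p hp =>
    exists_pattern_of_nonRecords hk hp.1 hp.2.1 hp.2.2 hc
  choose! σ hσ hpσ using this
  refine Set.ncard_le_ncard_of_injOn σ hσ ?_ (Set.toFinite _)
  intro p hp p' hp' hpp
  refine eq_of_nonRecords_eq hp.2.1 hp'.2.1 hp.2.2 hp'.2.2 fun i hi => ?_
  have : i ∈ Set.range (X.orderEmbOfFin rfl) := by
    rw [Finset.range_orderEmbOfFin]; simpa using hi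
  obtain ⟨j, rfl⟩ := this
  rw [hpσ p hp, hpσ p' hp', hpp]

/-- There are `C(n, N) ^ 2` choices for the positions and the values of `N` entries that are not
left-to-right maxima. -/
theorem numPermsWithOneCopy_succ_le {k : ℕ} (hk : 1 ≤ k) (n : ℕ) :
    numPermsWithOneCopy (decreasingPattern (k + 1)) n ≤
      ∑ N ∈ Finset.range (n + 1), n.choose N ^ 2 * numPermsWithOneCopy (decreasingPattern k) N := by
  classical
  set S := permsWithOneCopy (decreasingPattern (k + 1)) n with hS
  let T : Finset (Σ _ : ℕ, Finset (Fin n) × Finset (Fin n)) :=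
    (Finset.range (n + 1)).sigma fun N =>
      Finset.powersetCard N Finset.univ ×ˢ Finset.powersetCard N Finset.univ
  have hsub : S ⊆ ⋃ t ∈ T, {p ∈ S | nonRecords p = t.2.1 ∧ t.2.1.map p.toEmbedding = t.2.2} := by
    intro p hp
    simp only [Set.mem_iUnion]
    refine ⟨⟨(nonRecords p).card, nonRecords p, (nonRecords p).map p.toEmbedding⟩, ?_, hp, rfl, rfl⟩
    simp only [T, Finset.mem_sigma, Finset.mem_range, Finset.mem_product, Finset.mem_powersetCard,
      Finset.subset_univ, Finset.card_map, and_self, and_true]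
    exact Nat.lt_succ_of_le ((Finset.card_le_univ _).trans_eq (Fintype.card_fin n))
  calc S.ncard ≤ _ := Set.ncard_le_ncard hsub (Set.toFinite _)
    _ ≤ ∑ t ∈ T, {p ∈ S | nonRecords p = t.2.1 ∧ t.2.1.map p.toEmbedding = t.2.2}.ncard :=
      Finset.set_ncard_biUnion_le _ _
    _ ≤ ∑ t ∈ T, numPermsWithOneCopy (decreasingPattern k) t.1 := by
      refine Finset.sum_le_sum fun t ht => ?_
      have : t.2.1.card = t.1 := by
        simp only [T, Finset.mem_sigma, Finset.mem_product, Finset.mem_powersetCard] at ht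
        exact ht.2.1.2
      rw [← this]
      exact ncard_fiber_nonRecords_le hk _ _
    _ = _ := by
      rw [Finset.sum_sigma]
      refine Finset.sum_congr rfl fun N _ => ?_
      simp [sq]

/-! ### Permutations with one inversion -/

/-- A permutation with exactly one inversion is an adjacent transposition, and there are at most
`n` of these. -/
theorem numPermsWithOneCopy_two_le (n : ℕ) : numPermsWithOneCopy (decreasingPattern 2) n ≤ n := by
  have key : ∀ p ∈ permsWithOneCopy (decreasingPattern 2) n, ∃ i : Fin n,
      ∀ a b : Fin n, a < b ∧ p b < p a ↔ a = i ∧ b.1 = i.1 + 1 := by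
    intro p hp
    rw [mem_permsWithOneCopy_decreasing] at hp
    obtain ⟨e, he, huniq⟩ := hp
    have h01 : e 0 < e 1 := e.strictMono Fin.zero_lt_one
    have hp01 : p (e 1) < p (e 0) := he Fin.zero_lt_one
    have huniq' : ∀ a b : Fin n, a < b → p b < p a → a = e 0 ∧ b = e 1 := by
      intro a b hab hpab
      have hmono : StrictMono ![a, b] := by
        rw [Fin.strictMono_iff_lt_succ]; simpa [Fin.forall_fin_one] using hab
      have hanti : StrictAnti fun i => p (OrderEmbedding.ofStrictMono _ hmono i) := by
        rw [Fin.strictAnti_iff_succ_lt]; simpa [Fin.forall_fin_one] using hpab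
      have := huniq _ hanti
      constructor
      · rw [← this]; simp
      · rw [← this]; simp
    -- an entry between the two would form a second inversion with one of them
    have hadj : (e 1).1 = (e 0).1 + 1 := by
      by_contra hne
      have hlt : (e 0).1 < (e 1).1 := h01
      let m : Fin n := ⟨(e 0).1 + 1, by have := (e 1).2; omega⟩
      have h0m : e 0 < m := Fin.lt_def.2 (Nat.lt_succ_self _)
      have hm1 : m < e 1 := Fin.lt_def.2 (by change (e 0).1 + 1 < _; omega)
      rcases lt_or_ge (p m) (p (e 0)) with h | h
      · exact hm1.ne (huniq' _ _ h0m h).2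
      · exact h0m.ne' (huniq' _ _ hm1 (hp01.trans_le h)).1
    refine ⟨e 0, fun a b => ⟨fun h => ?_, fun h => ?_⟩⟩
    · obtain ⟨rfl, rfl⟩ := huniq' a b h.1 h.2
      exact ⟨rfl, hadj⟩
    · obtain ⟨rfl, hb⟩ := h
      have : b = e 1 := Fin.ext (hb.trans hadj.symm)
      subst this
      exact ⟨h01, hp01⟩
  rcases Nat.eq_zero_or_pos n with rfl | hn
  · have hempty : permsWithOneCopy (decreasingPattern 2) 0 = ∅ := by
      refine Set.eq_empty_of_forall_notMem fun p hp => ?_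
      obtain ⟨i, -⟩ := key p hp
      exact i.elim0
    rw [numPermsWithOneCopy, hempty, Set.ncard_empty]
  have : Nonempty (Fin n) := ⟨⟨0, hn⟩⟩
  choose! f hf using key
  refine (Set.ncard_le_ncard_of_injOn (t := Set.univ) f (fun _ _ => Set.mem_univ _) ?_
    (Set.toFinite _)).trans_eq (by simp)
  intro p hp q hq hpq
  -- permutations with the same inversions are equal
  have hinv : ∀ a b : Fin n, a < b → (p b < p a ↔ q b < q a) := by
    intro a b hab
    have h1 := hf p hp a b
    have h2 := hf q hq a b
    rw [hpq] at h1
    tauto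
  have hlt : ∀ a b : Fin n, p a < p b ↔ q a < q b := by
    intro a b
    rcases lt_trichotomy a b with h | rfl | h
    · rw [← not_iff_not, not_lt, not_lt]
      have h1 : p b ≤ p a ↔ p b < p a := ⟨fun h' => lt_of_le_of_ne h' (p.injective.ne h.ne'), le_of_lt⟩
      have h2 : q b ≤ q a ↔ q b < q a := ⟨fun h' => lt_of_le_of_ne h' (q.injective.ne h.ne'), le_of_lt⟩
      rw [h1, h2, hinv a b h]
    · simp
    · exact hinv b a h
  have hmono : StrictMono (p.symm.trans q) := by
    intro a b hab
    have := (hlt (p.symm a) (p.symm b)).1 (by simpa using hab)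
    simpa using this
  have hid := (Equiv.Perm.monotone_iff _).1 hmono.monotone
  ext1 i
  have := congrArg (fun s : Equiv.Perm (Fin n) => s (p i)) hid
  simpa using this.symm

/-! ### Ballot sequences -/

/-- Weakly increasing sequences of length `i` with entries below `m` whose `j`-th entry (counted from 0)
is at least `j`; these encode lattice paths that stay on one side of the diagonal. -/
def ballotSequences (i m : ℕ) : Set (Fin i → ℕ) :=
  {g | Monotone g ∧ ∀ j, j.1 ≤ g j ∧ g j < m}

theorem ballotSequences_finite (i m : ℕ) : (ballotSequences i m).Finite :=
  (Set.Finite.pi' fun _ : Fin i => Set.finite_Iio m).subset fun _ hg j => (hg.2 j).2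

theorem ncard_ballotSequences_zero_le (m : ℕ) : (ballotSequences 0 m).ncard ≤ 1 :=
  (Set.ncard_le_one_iff (ballotSequences_finite 0 m)).2 fun _ _ => Subsingleton.elim _ _

/-- Pascal-type recurrence, according to whether the last entry takes the greatest possible value. -/
theorem ncard_ballotSequences_succ_le (i m : ℕ) :
    (ballotSequences (i + 1) (m + 1)).ncard ≤
      (ballotSequences (i + 1) m).ncard + (ballotSequences i (m + 1)).ncard := by
  have hsub : ballotSequences (i + 1) (m + 1) ⊆ ballotSequences (i + 1) m ∪
      (fun g : Fin i → ℕ => (Fin.snoc g m : Fin (i + 1) → ℕ)) '' ballotSequences i (m + 1) := by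
    rintro g ⟨hmono, hg⟩
    by_cases hlast : g (Fin.last i) = m
    · right
      refine ⟨fun j => g j.castSucc, ⟨fun a b hab => hmono (by simpa using hab), fun j => ?_⟩, ?_⟩
      · simpa using hg j.castSucc
      · rw [← hlast]
        exact Fin.snoc_init_self g
    · left
      refine ⟨hmono, fun j => ⟨(hg j).1, ?_⟩⟩
      have h1 := hmono (Fin.le_last j)
      have h2 := (hg (Fin.last i)).2
      omega
  calc _ ≤ _ := Set.ncard_le_ncard hsub
        ((ballotSequences_finite _ _).union ((ballotSequences_finite _ _).image _))
    _ ≤ _ := Set.ncard_union_le _ _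
    _ ≤ _ := Nat.add_le_add_left (Set.ncard_image_le (ballotSequences_finite _ _)) _

theorem ncard_ballotSequences_self (i : ℕ) : (ballotSequences (i + 1) i).ncard = 0 := by
  rw [Set.ncard_eq_zero (ballotSequences_finite _ _)]
  ext g
  simp only [Set.mem_empty_iff_false, iff_false]
  rintro ⟨-, hg⟩
  have := hg (Fin.last i)
  simp at this
  omega

/-- The ballot numbers as an upper bound. -/
theorem ncard_ballotSequences_add_choose_le (i d : ℕ) :
    (ballotSequences (i + 1) (i + d)).ncard + (2 * i + 1 + d).choose i ≤
      (2 * i + 1 + d).choose (i + 1) := by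
  induction i generalizing d with
  | zero =>
    induction d with
    | zero => simp [ncard_ballotSequences_self]
    | succ d ih =>
      have h1 := ncard_ballotSequences_succ_le 0 (0 + d)
      have h2 := ncard_ballotSequences_zero_le (0 + d + 1)
      simp only [Nat.choose_zero_right, Nat.choose_one_right, zero_add, mul_zero] at *
      omega
  | succ i ih =>
    induction d with
    | zero =>
      rw [add_zero, ncard_ballotSequences_self, zero_add]
      exact (Nat.choose_symm_half (i + 1)).symm.le
    | succ d ihd =>
      have h1 := ncard_ballotSequences_succ_le (i + 1) (i + 1 + d)
      have h2 := ih (d + 2)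
      have e1 : 2 * (i + 1) + 1 + (d + 1) = (2 * i + 1 + (d + 2)) + 1 := by ring
      have e2 : 2 * (i + 1) + 1 + d = 2 * i + 1 + (d + 2) := by ring
      rw [e2] at ihd
      rw [e1, Nat.choose_succ_succ' _ i, Nat.choose_succ_succ' _ (i + 1)]
      have e3 : i + (d + 2) = i + 1 + d + 1 := by ring
      rw [e3] at h2
      have e4 : i + 1 + (d + 1) = i + 1 + d + 1 := by ring
      rw [e4]
      omega

theorem mul_ncard_ballotSequences_le (n : ℕ) :
    n * (ballotSequences n n).ncard ≤ n.centralBinom := by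
  rcases n with _ | i
  · simp
  have h := ncard_ballotSequences_add_choose_le i 1
  have h2 := Nat.choose_succ_right_eq (2 * i + 1 + 1) i
  have h3 : 2 * i + 1 + 1 - i = i + 2 := by omega
  rw [h3] at h2
  rw [Nat.centralBinom, show 2 * (i + 1) = 2 * i + 1 + 1 by ring]
  nlinarith

/-! ### Running maxima and permutations with one copy of `321` -/

/-- The running maximum of a permutation. -/
def runningMax {n : ℕ} (p : Equiv.Perm (Fin n)) (i : Fin n) : ℕ :=
  (Finset.Iic i).sup fun j => (p j).1

theorem le_runningMax {n : ℕ} (p : Equiv.Perm (Fin n)) {i j : Fin n} (h : j ≤ i) :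
    (p j).1 ≤ runningMax p i :=
  Finset.le_sup (f := fun j => (p j).1) (Finset.mem_Iic.2 h)

theorem exists_eq_runningMax {n : ℕ} (p : Equiv.Perm (Fin n)) (i : Fin n) :
    ∃ j ≤ i, runningMax p i = (p j).1 := by
  obtain ⟨j, hj, h⟩ := Finset.exists_mem_eq_sup (Finset.Iic i) ⟨i, Finset.mem_Iic.2 le_rfl⟩
    fun j => (p j).1
  exact ⟨j, Finset.mem_Iic.1 hj, h⟩

theorem runningMax_mono {n : ℕ} (p : Equiv.Perm (Fin n)) : Monotone (runningMax p) :=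
  fun _ _ h => Finset.sup_mono (Finset.Iic_subset_Iic.2 h)

theorem runningMax_mem_ballotSequences {n : ℕ} (p : Equiv.Perm (Fin n)) :
    runningMax p ∈ ballotSequences n n := by
  refine ⟨runningMax_mono p, fun j => ⟨?_, ?_⟩⟩
  · -- the first `j + 1` entries are distinct and at most the running maximum
    have hsub : (Finset.Iic j).image (fun i => (p i).1) ⊆ Finset.range (runningMax p j + 1) := by
      intro x hx
      obtain ⟨i, hi, rfl⟩ := Finset.mem_image.1 hx
      exact Finset.mem_range.2 (Nat.lt_succ_of_le (le_runningMax p (Finset.mem_Iic.1 hi)))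
    have := Finset.card_le_card hsub
    have hinj : Function.Injective fun i => (p i).1 := Fin.val_injective.comp p.injective
    rw [Finset.card_image_of_injective _ hinj, Fin.card_Iic,
      Finset.card_range] at this
    omega
  · obtain ⟨i, -, h⟩ := exists_eq_runningMax p j
    rw [h]; exact (p i).2

/-- The running maximum stays constant exactly at the entries that are not left-to-right maxima. -/
theorem mem_nonRecords_iff_runningMax {n : ℕ} {p : Equiv.Perm (Fin n)} {i : Fin n} :
    i ∈ nonRecords p ↔ ∃ j < i, runningMax p j = runningMax p i := by
  rw [mem_nonRecords]
  constructor
  · rintro ⟨j, hji, hp⟩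
    obtain ⟨a, hai, ha⟩ := exists_eq_runningMax p i
    have hne : a ≠ i := by
      rintro rfl
      have := le_runningMax p hji.le
      rw [ha] at this
      exact absurd hp (not_lt.2 this)
    refine ⟨a, lt_of_le_of_ne hai hne, le_antisymm (runningMax_mono p hai) ?_⟩
    rw [ha]; exact le_runningMax p le_rfl
  · rintro ⟨j, hji, hj⟩
    obtain ⟨a, haj, ha⟩ := exists_eq_runningMax p j
    refine ⟨a, haj.trans_lt hji, ?_⟩
    refine lt_of_le_of_ne ?_ (p.injective.ne (haj.trans_lt hji).ne')
    have := le_runningMax p (le_refl i)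
    rw [← hj, ha] at this
    exact this

/-- The values of the left-to-right maxima are the values of the running maximum. -/
theorem mem_map_nonRecords_iff_runningMax {n : ℕ} {p : Equiv.Perm (Fin n)} {y : Fin n} :
    y ∈ (nonRecords p).map p.toEmbedding ↔ ∀ j, runningMax p j ≠ y.1 := by
  obtain ⟨x, rfl⟩ := p.surjective y
  have : p x ∈ (nonRecords p).map p.toEmbedding ↔ x ∈ nonRecords p := by simp
  rw [this, mem_nonRecords]
  constructor
  · rintro ⟨j, hjx, hj⟩ i hi
    rcases lt_or_ge i x with h | h
    · obtain ⟨a, hai, ha⟩ := exists_eq_runningMax p i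
      rw [hi] at ha
      exact (hai.trans_lt h).ne' (p.injective (Fin.ext ha))
    · have := le_runningMax p (hjx.le.trans h)
      rw [hi] at this
      exact absurd hj (not_lt.2 this)
  · intro h
    by_contra hcon
    push Not at hcon
    obtain ⟨a, hax, ha⟩ := exists_eq_runningMax p x
    rcases eq_or_lt_of_le hax with rfl | hlt
    · exact h _ ha
    · exact h x (le_antisymm (ha ▸ hcon a hlt) (le_runningMax p le_rfl))

/-- Permutations with exactly one copy of `321` are determined by their running maxima, of which
there are at most a Catalan number, together with an adjacent transposition. -/
theorem numPermsWithOneCopy_three_le (n : ℕ) :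
    numPermsWithOneCopy (decreasingPattern 3) n ≤ n.centralBinom := by
  classical
  set S := permsWithOneCopy (decreasingPattern 3) n with hS
  set T := (ballotSequences_finite n n).toFinset with hT
  have hsub : S ⊆ ⋃ M ∈ T, {p ∈ S | runningMax p = M} := by
    intro p hp
    simp only [Set.mem_iUnion]
    exact ⟨runningMax p, (Set.Finite.mem_toFinset _).2 (runningMax_mem_ballotSequences p), hp, rfl⟩
  have hfib : ∀ M, {p ∈ S | runningMax p = M}.ncard ≤ n := by
    intro M
    rcases Set.eq_empty_or_nonempty {p ∈ S | runningMax p = M} with h | ⟨q, -, hq⟩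
    · rw [h]; simp
    have hle : {p ∈ S | runningMax p = M}.ncard ≤ {p ∈ S | nonRecords p = nonRecords q ∧
        (nonRecords q).map p.toEmbedding = (nonRecords q).map q.toEmbedding}.ncard := by
      refine Set.ncard_le_ncard ?_ (Set.toFinite _)
      rintro p ⟨hp, hpM⟩
      have hpq : runningMax p = runningMax q := hpM.trans hq.symm
      have h1 : nonRecords p = nonRecords q := by
        ext i
        rw [mem_nonRecords_iff_runningMax, mem_nonRecords_iff_runningMax, hpq]
      refine ⟨hp, h1, ?_⟩
      rw [← h1]
      ext y
      rw [mem_map_nonRecords_iff_runningMax, hpq, ← mem_map_nonRecords_iff_runningMax, h1]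
    refine hle.trans ((ncard_fiber_nonRecords_le (k := 2) (by norm_num) _ _).trans ?_)
    refine (numPermsWithOneCopy_two_le _).trans ?_
    exact (Finset.card_le_univ _).trans_eq (Fintype.card_fin n)
  calc S.ncard ≤ _ := Set.ncard_le_ncard hsub (Set.toFinite _)
    _ ≤ ∑ M ∈ T, {p ∈ S | runningMax p = M}.ncard := Finset.set_ncard_biUnion_le _ _
    _ ≤ ∑ _M ∈ T, n := Finset.sum_le_sum fun M _ => hfib M
    _ = n * (ballotSequences n n).ncard := by
      rw [Finset.sum_const, smul_eq_mul, mul_comm, hT, Set.ncard_eq_toFinset_card _ (ballotSequences_finite n n)]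
    _ ≤ n.centralBinom := mul_ncard_ballotSequences_le n

/-! ### Asymptotics of the upper bound -/

/-- An elementary form of `C(2n, n) = O(4 ^ n / √n)`. -/
theorem centralBinom_sq_mul_le (n : ℕ) : n.centralBinom ^ 2 * (2 * n + 1) ≤ 16 ^ n := by
  induction n with
  | zero => simp
  | succ n ih =>
    have h := Nat.succ_mul_centralBinom_succ n
    have h1 : (n + 1) ^ 2 * ((n + 1).centralBinom ^ 2 * (2 * (n + 1) + 1)) ≤
        (n + 1) ^ 2 * 16 ^ (n + 1) := by
      calc (n + 1) ^ 2 * ((n + 1).centralBinom ^ 2 * (2 * (n + 1) + 1))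
          = ((n + 1) * (n + 1).centralBinom) ^ 2 * (2 * n + 3) := by ring
        _ = (n.centralBinom ^ 2 * (2 * n + 1)) * (4 * (2 * n + 1) * (2 * n + 3)) := by rw [h]; ring
        _ ≤ 16 ^ n * (16 * (n + 1) ^ 2) := Nat.mul_le_mul ih (by nlinarith)
        _ = _ := by ring
    exact Nat.le_of_mul_le_mul_left h1 (by positivity)

theorem tendsto_centralBinom_div : Tendsto (fun n : ℕ => (n.centralBinom : ℝ) / 4 ^ n) atTop (𝓝 0) := by
  have hsq : Tendsto (fun n : ℕ => Real.sqrt (1 / ((n : ℝ) + 1))) atTop (𝓝 0) := by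
    have := (Real.continuous_sqrt.tendsto 0).comp tendsto_one_div_add_atTop_nhds_zero_nat
    rwa [Real.sqrt_zero] at this
  refine squeeze_zero (fun n => by positivity) (fun n => ?_) hsq
  apply Real.le_sqrt_of_sq_le
  rw [div_pow, div_le_div_iff₀ (by positivity) (by positivity), one_mul, ← pow_mul, mul_comm n 2,
    pow_mul]
  norm_num
  have h := centralBinom_sq_mul_le n
  have h' : ((n.centralBinom : ℝ)) ^ 2 * (2 * n + 1) ≤ 16 ^ n := by exact_mod_cast h
  refine le_trans ?_ h'
  gcongr
  linarith [(Nat.cast_nonneg n : (0 : ℝ) ≤ n)]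

/-- Averaging a null sequence `b N / (r ^ 2) ^ N` with squared binomial weights, which are bounded by
the probabilities `C(n, N) r ^ N / (r + 1) ^ n`, gives a null sequence. -/
theorem tendsto_sum_choose_sq {r : ℝ} (hr : 0 < r) {b : ℕ → ℝ} (hb : ∀ N, 0 ≤ b N)
    (h : Tendsto (fun N => b N / (r ^ 2) ^ N) atTop (𝓝 0)) :
    Tendsto (fun n => (∑ N ∈ Finset.range (n + 1), (n.choose N : ℝ) ^ 2 * b N) / ((r + 1) ^ 2) ^ n)
      atTop (𝓝 0) := by
  set δ : ℕ → ℝ := fun N => b N / (r ^ 2) ^ N with hδ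
  have hδ0 : ∀ N, 0 ≤ δ N := fun N => div_nonneg (hb N) (by positivity)
  set x : ℕ → ℕ → ℝ := fun n N => n.choose N * r ^ N / (r + 1) ^ n with hx
  have hx0 : ∀ n N, 0 ≤ x n N := fun n N => by positivity
  have hxsum : ∀ n, ∑ N ∈ Finset.range (n + 1), x n N = 1 := by
    intro n
    rw [← Finset.sum_div, div_eq_one_iff_eq (by positivity), add_pow]
    exact Finset.sum_congr rfl fun N _ => by ring
  have hx1 : ∀ n, ∀ N ∈ Finset.range (n + 1), x n N ≤ 1 := fun n N hN =>
    (Finset.single_le_sum (f := x n) (fun i _ => hx0 n i) hN).trans_eq (hxsum n)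
  have hle : ∀ n, (∑ N ∈ Finset.range (n + 1), (n.choose N : ℝ) ^ 2 * b N) / ((r + 1) ^ 2) ^ n ≤
      ∑ N ∈ Finset.range (n + 1), x n N * δ N := by
    intro n
    rw [Finset.sum_div]
    refine Finset.sum_le_sum fun N hN => ?_
    have : (n.choose N : ℝ) ^ 2 * b N / ((r + 1) ^ 2) ^ n = x n N ^ 2 * δ N := by
      simp only [hx, hδ]
      rw [← pow_mul, ← pow_mul, mul_comm 2 n, mul_comm 2 N, pow_mul, pow_mul]
      field_simp
    rw [this]
    refine mul_le_mul_of_nonneg_right ?_ (hδ0 N)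
    rw [sq]
    exact mul_le_of_le_one_left (hx0 _ _) (hx1 n N hN)
  have hxlim : ∀ N, Tendsto (fun n => x n N) atTop (𝓝 0) := by
    intro N
    have h1 := (tendsto_pow_const_div_const_pow_of_one_lt N (by linarith : 1 < r + 1)).mul_const (r ^ N)
    rw [zero_mul] at h1
    refine squeeze_zero (fun n => hx0 n N) (fun n => ?_) h1
    have : (n.choose N : ℝ) ≤ (n : ℝ) ^ N := by exact_mod_cast Nat.choose_le_pow n N
    calc x n N ≤ (n : ℝ) ^ N * r ^ N / (r + 1) ^ n := by simp only [hx]; gcongr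
      _ = _ := by ring
  refine squeeze_zero (fun n => div_nonneg (Finset.sum_nonneg fun N _ => mul_nonneg (sq_nonneg _) (hb N))
    (by positivity)) hle ?_
  rw [Metric.tendsto_atTop]
  intro ε hε
  obtain ⟨N₀, hN₀⟩ := (Metric.tendsto_atTop.1 h) (ε / 2) (by positivity)
  have hhead : Tendsto (fun n => ∑ N ∈ Finset.range N₀, x n N * δ N) atTop (𝓝 0) := by
    have := tendsto_finsetSum (Finset.range N₀) fun N _ => (hxlim N).mul_const (δ N)
    simpa using this
  obtain ⟨n₀, hn₀⟩ := (Metric.tendsto_atTop.1 hhead) (ε / 2) (by positivity)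
  refine ⟨n₀, fun n hn => ?_⟩
  have hd := hn₀ n hn
  rw [Real.dist_eq, sub_zero] at hd ⊢
  rw [abs_of_nonneg (Finset.sum_nonneg fun N _ => mul_nonneg (hx0 _ _) (hδ0 _))] at hd ⊢
  have hsplit : ∑ N ∈ Finset.range (n + 1), x n N * δ N ≤
      ∑ N ∈ Finset.range (n + 1), x n N * (ε / 2) + ∑ N ∈ Finset.range N₀, x n N * δ N := by
    rw [← Finset.sum_filter_add_sum_filter_not (Finset.range (n + 1)) (fun N => N₀ ≤ N)
      (fun N => x n N * δ N)]
    refine add_le_add ?_ ?_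
    · refine (Finset.sum_le_sum fun N hN => ?_).trans (Finset.sum_le_sum_of_subset_of_nonneg
        (Finset.filter_subset (fun N => N₀ ≤ N) _) fun N _ _ => mul_nonneg (hx0 n N) (by positivity))
      have h1 := hN₀ N (Finset.mem_filter.1 hN).2
      rw [Real.dist_eq, sub_zero, abs_of_nonneg (hδ0 N)] at h1
      exact mul_le_mul_of_nonneg_left h1.le (hx0 _ _)
    · refine Finset.sum_le_sum_of_subset_of_nonneg (fun N hN => ?_)
        fun N _ _ => mul_nonneg (hx0 n N) (hδ0 N)
      exact Finset.mem_range.2 (not_le.1 (Finset.mem_filter.1 hN).2)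
  rw [← Finset.sum_mul, hxsum, one_mul] at hsplit
  linarith

/-- With `k = d + 3`: permutations with exactly one decreasing subsequence of length `k` number
`o((k - 1) ^ (2 n))`. -/
theorem tendsto_numPermsWithOneCopy_div (d : ℕ) :
    Tendsto (fun n => (numPermsWithOneCopy (decreasingPattern (d + 3)) n : ℝ) /
      (((d : ℝ) + 2) ^ 2) ^ n) atTop (𝓝 0) := by
  induction d with
  | zero =>
    refine squeeze_zero (fun n => by positivity) (fun n => ?_) tendsto_centralBinom_div
    norm_num
    gcongr
    exact_mod_cast numPermsWithOneCopy_three_le n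
  | succ d ih =>
    have := tendsto_sum_choose_sq (r := (d : ℝ) + 2) (by positivity) (fun N => Nat.cast_nonneg _) ih
    refine squeeze_zero (fun n => by positivity) (fun n => ?_) this
    have e : ((d + 1 : ℕ) : ℝ) + 2 = (d : ℝ) + 2 + 1 := by push_cast; ring
    rw [e]
    gcongr
    exact_mod_cast numPermsWithOneCopy_succ_le (k := d + 3) (by omega) n

/-! ### Adding a single copy to an avoiding permutation -/

/-- The permutations of length `n` without a decreasing subsequence of length `k`. -/
def permsAvoidingDecreasing (k n : ℕ) : Set (Equiv.Perm (Fin n)) :=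
  {p | ∀ e : Fin k ↪o Fin n, ¬ StrictAnti fun i => p (e i)}

/-- The direct sum of the decreasing permutation of length `k` and a permutation without a decreasing
subsequence of length `k` has exactly one decreasing subsequence of length `k`. -/
theorem ncard_permsAvoidingDecreasing_le {k : ℕ} (hk : 1 ≤ k) (n : ℕ) :
    (permsAvoidingDecreasing k n).ncard ≤ numPermsWithOneCopy (decreasingPattern k) (k + n) := by
  let F : Equiv.Perm (Fin n) → Equiv.Perm (Fin (k + n)) := fun p =>
    finSumFinEquiv.symm.trans ((Equiv.sumCongr Fin.revPerm p).trans finSumFinEquiv)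
  have hl : ∀ p i, F p (Fin.castAdd n i) = Fin.castAdd n i.rev := fun p i => by simp [F]
  have hr : ∀ p i, F p (Fin.natAdd k i) = Fin.natAdd k (p i) := fun p i => by simp [F]
  refine Set.ncard_le_ncard_of_injOn F ?_ ?_ (Set.toFinite _)
  · intro p hp
    rw [mem_permsWithOneCopy_decreasing]
    refine ⟨Fin.castAddOrderEmb n, ?_, ?_⟩
    · intro i j hij
      change F p (Fin.castAdd n j) < F p (Fin.castAdd n i)
      rw [hl, hl]
      exact Fin.rev_lt_rev.2 hij
    · intro e he
      obtain ⟨m, rfl⟩ : ∃ m, k = m + 1 := ⟨k - 1, by omega⟩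
      rcases lt_or_ge (e (Fin.last m)).1 (m + 1) with hlast | hlast
      · have hlt : ∀ i, (e i).1 < m + 1 := fun i =>
          lt_of_le_of_lt (e.monotone (Fin.le_last i)) hlast
        have hmono : StrictMono fun i => (⟨(e i).1, hlt i⟩ : Fin (m + 1)) := fun i j hij =>
          e.strictMono hij
        ext1 i
        have h1 := (hmono.range_inj strictMono_id).1 (by
          rw [Set.range_id, Set.range_eq_univ]
          exact Finite.surjective_of_injective hmono.injective)
        have h2 := congrArg Fin.val (congrFun h1 i)
        exact Fin.ext h2
      · exfalso
        have hval : ∀ x : Fin (m + 1 + n), m + 1 ≤ (F p x).1 ↔ m + 1 ≤ x.1 := by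
          intro x
          refine Fin.addCases (fun i => ?_) (fun i => ?_) x
          · rw [hl]; simp [Fin.castAdd]; omega
          · rw [hr]; simp [Fin.natAdd]
        have hge : ∀ i, m + 1 ≤ (e i).1 := by
          intro i
          rw [← hval]
          exact ((hval _).2 hlast).trans (he.antitone (Fin.le_last i))
        have hex : ∀ i, ∃ j : Fin n, e i = Fin.natAdd (m + 1) j := fun i =>
          ⟨⟨(e i).1 - (m + 1), by have := (e i).2; have := hge i; omega⟩, Fin.ext (by
            have := hge i; simp; omega)⟩
        choose f hf using hex
        have hfm : StrictMono f := by
          intro i j hij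
          have := e.strictMono hij
          rw [hf, hf] at this
          exact Nat.lt_of_add_lt_add_left this
        refine hp (OrderEmbedding.ofStrictMono f hfm) ?_
        intro i j hij
        have := he hij
        simp only [hf, hr] at this
        exact Nat.lt_of_add_lt_add_left this
  · intro p _ q _ hpq
    ext1 i
    have := congrArg (fun s : Equiv.Perm (Fin (k + n)) => s (Fin.natAdd k i)) hpq
    simpa [hr] using this

/-! ### Permutations from pairs of standard fillings -/

/-- A standard filling of the `r × m` rectangle with the numbers `0, …, n - 1` (so that `n = r * m`
if one exists): an enumeration of the cells that increases along rows and along columns. -/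
structure IsStandardFilling {r m n : ℕ} (φ : Fin r × Fin m ≃ Fin n) : Prop where
  row : ∀ c, StrictMono fun j => φ (c, j)
  col : ∀ j, StrictMono fun c => φ (c, j)

/-- The permutation that sends the position of a cell in the filling `φ` to the value of the cell
in `ψ` turned upside down. Each row becomes an increasing subsequence, and each column becomes a
decreasing one. -/
def permOfFillings {r m n : ℕ} (φ ψ : Fin r × Fin m ≃ Fin n) : Equiv.Perm (Fin n) :=
  φ.symm.trans ((Equiv.prodCongr Fin.revPerm (Equiv.refl _)).trans ψ)

theorem permOfFillings_apply {r m n : ℕ} (φ ψ : Fin r × Fin m ≃ Fin n) (c : Fin r) (j : Fin m) :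
    permOfFillings φ ψ (φ (c, j)) = ψ (c.rev, j) := by
  simp [permOfFillings]

theorem permOfFillings_mem {r m n : ℕ} {φ ψ : Fin r × Fin m ≃ Fin n} (hφ : IsStandardFilling φ)
    (hψ : IsStandardFilling ψ) : permOfFillings φ ψ ∈ permsAvoidingDecreasing (r + 1) n := by
  intro e he
  obtain ⟨i, i', hne, heq⟩ := Fintype.exists_ne_map_eq_of_card_lt
    (fun i => (φ.symm (e i)).1) (by simp)
  wlog hlt : i < i' generalizing i i'
  · exact this i' i hne.symm heq.symm (lt_of_le_of_ne (not_lt.1 hlt) hne.symm)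
  obtain ⟨⟨c, j⟩, hx⟩ := φ.surjective (e i)
  obtain ⟨⟨c', j'⟩, hx'⟩ := φ.surjective (e i')
  rw [← hx, ← hx', Equiv.symm_apply_apply, Equiv.symm_apply_apply] at heq
  obtain rfl : c = c' := heq
  have h1 := e.strictMono hlt
  rw [← hx, ← hx'] at h1
  have h2 : permOfFillings φ ψ (e i') < permOfFillings φ ψ (e i) := he hlt
  rw [← hx, ← hx', permOfFillings_apply, permOfFillings_apply] at h2
  exact lt_asymm h2 (hψ.row _ ((hφ.row c).lt_iff_lt.1 h1))

/-- If an entry had row `c` for one pair of fillings and a smaller row `c'` for another one, the top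
part of its column for the first pair and the bottom part of its column for the second pair would
form a decreasing sequence that is too long. -/
theorem row_le_of_permOfFillings_eq {r m n : ℕ} {φ ψ φ' ψ' : Fin r × Fin m ≃ Fin n}
    (hφ : IsStandardFilling φ) (hψ : IsStandardFilling ψ) (hφ' : IsStandardFilling φ')
    (hψ' : IsStandardFilling ψ') (h : permOfFillings φ ψ = permOfFillings φ' ψ')
    {c c' : Fin r} {j j' : Fin m} (hx : φ (c, j) = φ' (c', j')) : c ≤ c' := by
  by_contra hcc
  rw [not_le] at hcc
  have hanti : ∀ {φ ψ : Fin r × Fin m ≃ Fin n} (_ : IsStandardFilling ψ) (j : Fin m) {a b : Fin r},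
      a < b → permOfFillings φ ψ (φ (b, j)) < permOfFillings φ ψ (φ (a, j)) := by
    intro φ ψ hψ j a b hab
    rw [permOfFillings_apply, permOfFillings_apply]
    exact hψ.col j (Fin.rev_lt_rev.2 hab)
  let f : Fin (r + 1) → Fin n := fun i =>
    if hi : i.1 ≤ c.1 then φ (⟨i.1, hi.trans_lt c.2⟩, j) else φ' (⟨i.1 - 1, by omega⟩, j')
  have hstep : ∀ i : Fin r, f i.castSucc < f i.succ ∧
      permOfFillings φ ψ (f i.succ) < permOfFillings φ ψ (f i.castSucc) := by
    intro i
    have hcc' : c'.1 < c.1 := hcc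
    rcases lt_trichotomy i.1 c.1 with hi | hi | hi
    · have e1 : f i.castSucc = φ (i, j) := by simp [f, hi.le]
      have e2 : f i.succ = φ (⟨i.1 + 1, by omega⟩, j) := by
        simp only [f, Fin.val_succ]; rw [dif_pos (by omega)]
      have hlt : i < ⟨i.1 + 1, by omega⟩ := Fin.lt_def.2 (Nat.lt_succ_self _)
      rw [e1, e2]
      exact ⟨hφ.col j hlt, hanti hψ j hlt⟩
    · have e1 : f i.castSucc = φ' (c', j') := by
        rw [← hx]; simp [f, hi]
      have e2 : f i.succ = φ' (i, j') := by
        simp only [f, Fin.val_succ]; rw [dif_neg (by omega)]; simp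
      have hlt : c' < i := Fin.lt_def.2 (by omega)
      rw [e1, e2, h]
      exact ⟨hφ'.col j' hlt, hanti hψ' j' hlt⟩
    · have e1 : f i.castSucc = φ' (⟨i.1 - 1, by omega⟩, j') := by
        simp only [f, Fin.val_castSucc]; rw [dif_neg (by omega)]
      have e2 : f i.succ = φ' (i, j') := by
        simp only [f, Fin.val_succ]; rw [dif_neg (by omega)]; simp
      have hlt : (⟨i.1 - 1, by omega⟩ : Fin r) < i := Fin.lt_def.2 (by change i.1 - 1 < i.1; omega)
      rw [e1, e2, h]
      exact ⟨hφ'.col j' hlt, hanti hψ' j' hlt⟩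
  have hf : StrictMono f := Fin.strictMono_iff_lt_succ.2 fun i => (hstep i).1
  exact permOfFillings_mem hφ hψ (OrderEmbedding.ofStrictMono f hf)
    (Fin.strictAnti_iff_succ_lt.2 fun i => (hstep i).2)

theorem permOfFillings_injective {r m n : ℕ} {φ ψ φ' ψ' : Fin r × Fin m ≃ Fin n}
    (hφ : IsStandardFilling φ) (hψ : IsStandardFilling ψ) (hφ' : IsStandardFilling φ')
    (hψ' : IsStandardFilling ψ') (h : permOfFillings φ ψ = permOfFillings φ' ψ') :
    φ = φ' ∧ ψ = ψ' := by
  have hrow : ∀ {c c' : Fin r} {j j' : Fin m}, φ (c, j) = φ' (c', j') → c = c' := fun hx =>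
    le_antisymm (row_le_of_permOfFillings_eq hφ hψ hφ' hψ' h hx)
      (row_le_of_permOfFillings_eq hφ' hψ' hφ hψ h.symm hx.symm)
  have hφφ : φ = φ' := by
    have : ∀ c, (fun j => φ (c, j)) = fun j => φ' (c, j) := by
      intro c
      refine ((hφ.row c).range_inj (hφ'.row c)).1 (Set.ext fun x => ⟨?_, ?_⟩)
      · rintro ⟨j, rfl⟩
        obtain ⟨⟨c', j'⟩, hx⟩ := φ'.surjective (φ (c, j))
        obtain rfl := hrow hx.symm
        exact ⟨j', hx⟩
      · rintro ⟨j, rfl⟩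
        obtain ⟨⟨c', j'⟩, hx⟩ := φ.surjective (φ' (c, j))
        obtain rfl := hrow hx
        exact ⟨j', hx⟩
    ext1 ⟨c, j⟩
    exact congrFun (this c) j
  subst hφφ
  refine ⟨rfl, Equiv.ext fun ⟨c, j⟩ => ?_⟩
  have h1 := permOfFillings_apply φ ψ c.rev j
  rw [h, permOfFillings_apply, Fin.rev_rev] at h1
  exact h1.symm

theorem ncard_standardFillings_sq_le (r m n : ℕ) :
    {φ : Fin r × Fin m ≃ Fin n | IsStandardFilling φ}.ncard ^ 2 ≤
      (permsAvoidingDecreasing (r + 1) n).ncard := by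
  rw [sq, ← Set.ncard_prod]
  refine Set.ncard_le_ncard_of_injOn (fun x => permOfFillings x.1 x.2) ?_ ?_ (Set.toFinite _)
  · rintro ⟨φ, ψ⟩ ⟨hφ, hψ⟩
    exact permOfFillings_mem hφ hψ
  · rintro ⟨φ, ψ⟩ ⟨hφ, hψ⟩ ⟨φ', ψ'⟩ ⟨hφ', hψ'⟩ h
    obtain ⟨h1, h2⟩ := permOfFillings_injective hφ hψ hφ' hψ' h
    exact Prod.ext h1 h2

/-! ### Counting standard fillings -/

/-- A filling of the `r × l` rectangle with the numbers `0, …, r * l - 1` that increases along rows. -/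
abbrev RowFilling (r l : ℕ) : Type :=
  {β : Fin r × Fin l ≃ Fin (r * l) // ∀ c, StrictMono fun j => β (c, j)}

/-- Every filling arises from a row-increasing one by permuting each row. -/
theorem factorial_le_card_rowFilling (r l : ℕ) :
    (r * l).factorial ≤ Nat.card (RowFilling r l) * l.factorial ^ r := by
  let G : RowFilling r l × (Fin r → Equiv.Perm (Fin l)) → (Fin r × Fin l ≃ Fin (r * l)) :=
    fun x => (Equiv.prodShear (Equiv.refl _) x.2).trans x.1.1
  have hG : Function.Surjective G := by
    intro β
    let τ : Fin r → Equiv.Perm (Fin l) := fun c => Tuple.sort fun j => β (c, j)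
    refine ⟨⟨⟨(Equiv.prodShear (Equiv.refl _) τ).trans β, fun c => ?_⟩, fun c => (τ c)⁻¹⟩, ?_⟩
    · have hm : Monotone fun j => β (c, τ c j) := Tuple.monotone_sort fun j => β (c, j)
      refine hm.strictMono_of_injective fun j j' h => ?_
      have := β.injective h
      simpa using this
    · ext1 ⟨c, j⟩
      simp [G]
  have h := Nat.card_le_card_of_surjective G hG
  have h1 : Nat.card (Fin r × Fin l ≃ Fin (r * l)) = (r * l).factorial := by
    rw [Nat.card_eq_fintype_card, Fintype.card_equiv finProdFinEquiv]
    simp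
  have h2 : Nat.card (Fin r → Equiv.Perm (Fin l)) = l.factorial ^ r := by
    simp [Nat.card_eq_fintype_card, Fintype.card_perm]
  rwa [h1, Nat.card_prod, h2] at h

/-- An injective key on a set of `n` elements enumerates the set in the order of the keys. -/
theorem exists_equiv_fin_of_injective {α : Type*} [Fintype α] {n : ℕ} (hn : Fintype.card α = n)
    {key : α → ℕ} (hkey : Function.Injective key) :
    ∃ φ : α ≃ Fin n, ∀ x y, φ x < φ y ↔ key x < key y := by
  have hc : (Finset.univ.image key).card = n := by
    rw [Finset.card_image_of_injective _ hkey, Finset.card_univ, hn]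
  let g : α → Fin n := fun x => ((Finset.univ.image key).orderIsoOfFin hc).symm
    ⟨key x, Finset.mem_image_of_mem _ (Finset.mem_univ x)⟩
  have hg : ∀ x y, g x < g y ↔ key x < key y := fun x y => by simp [g]
  have hinj : Function.Injective g := fun x y h =>
    hkey (by simpa [g] using h)
  refine ⟨Equiv.ofBijective g ((Fintype.bijective_iff_injective_and_card g).2 ⟨hinj, by simp [hn]⟩), hg⟩

/-- The rectangle with `r` rows is cut into blocks of `l` consecutive cells of a row, and block `q` of
row `c` is put into region `c + q`. Cells are ordered by their region first, and inside region
`R` by the row filling `B R`. -/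
def blockKey {r l : ℕ} (hl : 0 < l) (B : ℕ → RowFilling r l) (t : ℕ)
    (x : Fin r × Fin ((t + r) * l)) : ℕ :=
  (x.1.1 + x.2.1 / l) * (r * l) + ((B (x.1.1 + x.2.1 / l)).1 (x.1, ⟨x.2.1 % l, Nat.mod_lt _ hl⟩)).1

theorem mul_add_lt_of_lt {a b N x y : ℕ} (hab : a < b) (hx : x < N) : a * N + x < b * N + y := by
  have : (a + 1) * N ≤ b * N := Nat.mul_le_mul_right _ hab
  rw [add_mul, one_mul] at this
  omega

theorem blockKey_injective {r l : ℕ} (hl : 0 < l) (B : ℕ → RowFilling r l) (t : ℕ) :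
    Function.Injective (blockKey hl B t) := by
  rintro ⟨c, j⟩ ⟨c', j'⟩ h
  have hR : c.1 + j.1 / l = c'.1 + j'.1 / l := by
    rcases lt_trichotomy (c.1 + j.1 / l) (c'.1 + j'.1 / l) with hlt | heq | hlt
    · exact absurd h (mul_add_lt_of_lt hlt (Fin.is_lt _)).ne
    · exact heq
    · exact absurd h (mul_add_lt_of_lt hlt (Fin.is_lt _)).ne'
  simp only [blockKey, hR, Nat.add_left_cancel_iff] at h
  have h2 := (B _).1.injective (Fin.ext h)
  simp only [Prod.mk.injEq, Fin.mk.injEq] at h2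
  obtain ⟨rfl, hmod⟩ := h2
  have hdiv : j.1 / l = j'.1 / l := by omega
  have : j.1 = j'.1 := by rw [← Nat.div_add_mod j.1 l, ← Nat.div_add_mod j'.1 l, hdiv, hmod]
  rw [Fin.ext this]

theorem blockKey_row {r l : ℕ} (hl : 0 < l) (B : ℕ → RowFilling r l) (t : ℕ) (c : Fin r) :
    StrictMono fun j => blockKey hl B t (c, j) := by
  intro j j' hjj
  rcases (Nat.div_le_div_right (c := l) hjj.le).lt_or_eq with hlt | heq
  · exact mul_add_lt_of_lt (Nat.add_lt_add_left hlt _) (Fin.is_lt _)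
  · simp only [blockKey, heq]
    refine Nat.add_lt_add_left ((B _).2 c ?_) _
    rw [Fin.mk_lt_mk]
    have h1 := Nat.div_add_mod j.1 l
    have h2 := Nat.div_add_mod j'.1 l
    have h3 : j.1 < j'.1 := hjj
    rw [heq] at h1
    omega

theorem blockKey_col {r l : ℕ} (hl : 0 < l) (B : ℕ → RowFilling r l) (t : ℕ)
    (j : Fin ((t + r) * l)) : StrictMono fun c => blockKey hl B t (c, j) :=
  fun _ _ hcc => mul_add_lt_of_lt (Nat.add_lt_add_right hcc _) (Fin.is_lt _)

/-- The regions `r, …, r + t - 1` meet every row, so the order of the cells in such a region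
determines its row filling. -/
theorem eq_of_blockKey_lt_iff {r l : ℕ} (hl : 0 < l) {B B' : ℕ → RowFilling r l} {t : ℕ}
    (h : ∀ x y, blockKey hl B t x < blockKey hl B t y ↔ blockKey hl B' t x < blockKey hl B' t y)
    {b : ℕ} (hb : b < t) : B (r + b) = B' (r + b) := by
  let cell : Fin r × Fin l → Fin r × Fin ((t + r) * l) := fun x =>
    (x.1, ⟨(r + b - x.1.1) * l + x.2.1, by
      have h1 : r + b - x.1.1 < t + r := by omega
      have := mul_add_lt_of_lt (y := 0) h1 x.2.2
      simpa using this⟩)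
  have hcell : ∀ (B : ℕ → RowFilling r l) x,
      blockKey hl B t (cell x) = (r + b) * (r * l) + ((B (r + b)).1 x).1 := by
    rintro B ⟨c, s⟩
    have h1 : ((r + b - c.1) * l + s.1) / l = r + b - c.1 := by
      rw [Nat.add_comm, Nat.add_mul_div_right _ _ hl, Nat.div_eq_of_lt s.2, zero_add]
    have h2 : ((r + b - c.1) * l + s.1) % l = s.1 := by
      rw [Nat.add_comm, Nat.add_mul_mod_self_right, Nat.mod_eq_of_lt s.2]
    have h3 : c.1 + (r + b - c.1) = r + b := by omega
    simp only [blockKey, cell, h1, h2, h3]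
  have hlt : ∀ x y, (B (r + b)).1 x < (B (r + b)).1 y ↔ (B' (r + b)).1 x < (B' (r + b)).1 y := by
    intro x y
    have := h (cell x) (cell y)
    rwa [hcell, hcell, hcell, hcell, Nat.add_lt_add_iff_left, Nat.add_lt_add_iff_left] at this
  have hmono : StrictMono ((B (r + b)).1.symm.trans (B' (r + b)).1) := by
    intro a a' haa
    have := (hlt ((B (r + b)).1.symm a) ((B (r + b)).1.symm a')).1 (by simpa using haa)
    simpa using this
  have hid := (Equiv.Perm.monotone_iff _).1 hmono.monotone
  apply Subtype.ext
  ext1 x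
  have := congrArg (fun s : Equiv.Perm (Fin (r * l)) => s ((B (r + b)).1 x)) hid
  simpa using this.symm

/-- The row fillings of `t` regions can be chosen independently; the incomplete regions at both ends
are filled in a fixed way. -/
theorem card_rowFilling_pow_le (r t : ℕ) {l : ℕ} (hl : 0 < l) :
    Nat.card (RowFilling r l) ^ t ≤
      {φ : Fin r × Fin ((t + r) * l) ≃ Fin (r * ((t + r) * l)) | IsStandardFilling φ}.ncard := by
  let β₀ : RowFilling r l := ⟨finProdFinEquiv, fun c j j' h => Nat.add_lt_add_right h _⟩
  let ext : (Fin t → RowFilling r l) → ℕ → RowFilling r l := fun B R =>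
    if h : R - r < t then B ⟨R - r, h⟩ else β₀
  have hex : ∀ B : Fin t → RowFilling r l,
      ∃ φ : Fin r × Fin ((t + r) * l) ≃ Fin (r * ((t + r) * l)),
        ∀ x y, φ x < φ y ↔ blockKey hl (ext B) t x < blockKey hl (ext B) t y := fun B =>
    exists_equiv_fin_of_injective (by simp) (blockKey_injective hl (ext B) t)
  choose φ hφ using hex
  have hst : ∀ B, IsStandardFilling (φ B) := fun B =>
    ⟨fun c _ _ h => (hφ B _ _).2 (blockKey_row hl _ t c h),
      fun j _ _ h => (hφ B _ _).2 (blockKey_col hl _ t j h)⟩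
  have hinj : Function.Injective φ := by
    intro B B' h
    funext b
    have := eq_of_blockKey_lt_iff hl (B := ext B) (B' := ext B') (t := t)
      (fun x y => by rw [← hφ, ← hφ, h]) b.2
    simpa [ext] using this
  have hcard : Nat.card (RowFilling r l) ^ t = (Set.univ : Set (Fin t → RowFilling r l)).ncard := by
    rw [Set.ncard_univ, Nat.card_fun]
    simp
  rw [hcard]
  exact Set.ncard_le_ncard_of_injOn φ (fun B _ => hst B) hinj.injOn (Set.toFinite _)

/-! ### Exponential growth rate -/

theorem le_of_forall_pow_le_mul_pow {x y C : ℝ} (hy : 0 < y)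
    (h : ∀ t : ℕ, x ^ t ≤ C * y ^ t) : x ≤ y := by
  by_contra hlt
  rw [not_le] at hlt
  have h1 : 1 < x / y := (one_lt_div hy).2 hlt
  obtain ⟨t, ht⟩ := pow_unbounded_of_one_lt C h1
  rw [div_pow, lt_div_iff₀ (by positivity)] at ht
  exact absurd (h t) (not_le.2 ht)

theorem factorial_le_exp_mul_pow {n : ℕ} (hn : n ≠ 0) :
    (n.factorial : ℝ) ≤ Real.exp 1 * n * (n / Real.exp 1) ^ n := by
  obtain ⟨m, rfl⟩ := Nat.exists_eq_succ_of_ne_zero hn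
  have h : Stirling.stirlingSeq (m + 1) ≤ Stirling.stirlingSeq 1 :=
    Stirling.stirlingSeq'_antitone (Nat.zero_le m)
  rw [Stirling.stirlingSeq_one, Stirling.stirlingSeq, div_le_iff₀ (by positivity)] at h
  refine h.trans ?_
  have hm : (1 : ℝ) ≤ (m + 1 : ℕ) := by exact_mod_cast Nat.succ_le_succ (Nat.zero_le m)
  have h2 : Real.sqrt ((m + 1 : ℕ) : ℝ) ≤ (m + 1 : ℕ) := by
    rw [Real.sqrt_le_left (by positivity)]
    nlinarith
  rw [Real.sqrt_mul (by norm_num)]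
  have : Real.exp 1 / √2 * (√2 * √((m + 1 : ℕ) : ℝ) * (((m + 1 : ℕ) : ℝ) / Real.exp 1) ^ (m + 1)) =
      Real.exp 1 * √((m + 1 : ℕ) : ℝ) * (((m + 1 : ℕ) : ℝ) / Real.exp 1) ^ (m + 1) := by
    field_simp
  rw [this]
  gcongr

theorem pow_div_exp_le_factorial (n : ℕ) : ((n : ℝ) / Real.exp 1) ^ n ≤ n.factorial := by
  have h := Real.pow_div_factorial_le_exp (n : ℝ) (Nat.cast_nonneg n) n
  rw [div_le_iff₀ (by positivity)] at h
  rw [div_pow, div_le_iff₀ (by positivity), ← Real.exp_nat_mul, mul_one, mul_comm]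
  exact h

/-- The multinomial coefficients `(r l)! / (l!) ^ r` have exponential growth rate `r` per letter. -/
theorem sq_le_of_factorial_sq_le {r : ℕ} (hr : 1 ≤ r) {ρ : ℝ} (hρ : 0 < ρ)
    (h : ∀ l : ℕ, 0 < l → (((r * l).factorial : ℝ)) ^ 2 ≤ ρ ^ (r * l) * ((l.factorial : ℝ) ^ r) ^ 2) :
    (r : ℝ) ^ 2 ≤ ρ := by
  by_contra hlt
  rw [not_le] at hlt
  have hr0 : (0 : ℝ) < r := by exact_mod_cast hr
  set y : ℝ := r ^ 2 / ρ with hy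
  have hy1 : 1 < y := (one_lt_div hρ).2 hlt
  have key : ∀ l : ℕ, 0 < l → y ^ l ≤ (Real.exp 1 * l) ^ 2 := by
    intro l hl
    have hl0 : (0 : ℝ) < l := by exact_mod_cast hl
    set E := Real.exp 1
    have hE : 0 < E := Real.exp_pos 1
    have h1 : ((((r * l : ℕ) : ℝ) / E) ^ (r * l)) ^ 2 ≤
        ρ ^ (r * l) * ((E * l * (l / E) ^ l) ^ r) ^ 2 := by
      refine (pow_le_pow_left₀ (by positivity) (pow_div_exp_le_factorial _) 2).trans ((h l hl).trans ?_)
      gcongr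
      exact factorial_le_exp_mul_pow hl.ne'
    have h2 : ((((r * l : ℕ) : ℝ) / E) ^ (r * l)) ^ 2 =
        (y ^ l) ^ r * (ρ ^ (r * l) * (((l / E) ^ l) ^ r) ^ 2) := by
      rw [hy, Nat.cast_mul]
      simp only [div_pow, mul_pow, ← pow_mul]
      field_simp
      ring_nf
    have h3 : ρ ^ (r * l) * ((E * l * (l / E) ^ l) ^ r) ^ 2 =
        ((E * l) ^ 2) ^ r * (ρ ^ (r * l) * (((l / E) ^ l) ^ r) ^ 2) := by ring
    rw [h2, h3] at h1
    have h4 := le_of_mul_le_mul_right h1 (by positivity)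
    exact le_of_pow_le_pow_left₀ (by omega) (by positivity) h4
  have hlim := (tendsto_pow_const_div_const_pow_of_one_lt 2 hy1).const_mul (Real.exp 1 ^ 2)
  rw [mul_zero] at hlim
  obtain ⟨l, hl, hl0⟩ := ((hlim.eventually (gt_mem_nhds one_pos)).and (eventually_gt_atTop 0)).exists
  have h5 := key l hl0
  rw [← mul_div_assoc, div_lt_one (by positivity), ← mul_pow] at hl
  exact absurd h5 (not_le.2 hl)

/-- The number of permutations with exactly one decreasing subsequence of length `r + 1` has exponential
growth rate at least `r ^ 2`. -/
theorem sq_le_of_numPermsWithOneCopy_le {r : ℕ} (hr : 1 ≤ r) {ρ C : ℝ} (hρ : 0 < ρ)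
    (h : ∀ n, (numPermsWithOneCopy (decreasingPattern (r + 1)) n : ℝ) ≤ C * ρ ^ n) :
    (r : ℝ) ^ 2 ≤ ρ := by
  refine sq_le_of_factorial_sq_le hr hρ fun l hl => ?_
  have hK : ((Nat.card (RowFilling r l) : ℝ)) ^ 2 ≤ ρ ^ (r * l) := by
    refine le_of_forall_pow_le_mul_pow (C := C * ρ ^ (r + 1 + r * (r * l))) (by positivity)
      fun t => ?_
    have h1 : (Nat.card (RowFilling r l) ^ t) ^ 2 ≤
        numPermsWithOneCopy (decreasingPattern (r + 1)) (r + 1 + r * ((t + r) * l)) :=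
      (Nat.pow_le_pow_left (card_rowFilling_pow_le r t hl) 2).trans
        ((ncard_standardFillings_sq_le _ _ _).trans
          (ncard_permsAvoidingDecreasing_le (Nat.le_add_left 1 r) _))
    have h2 : (((Nat.card (RowFilling r l) : ℝ)) ^ t) ^ 2 ≤ C * ρ ^ (r + 1 + r * ((t + r) * l)) :=
      le_trans (by exact_mod_cast h1) (h _)
    calc (((Nat.card (RowFilling r l) : ℝ)) ^ 2) ^ t = ((Nat.card (RowFilling r l) : ℝ) ^ t) ^ 2 := by
          rw [← pow_mul, ← pow_mul, mul_comm]
      _ ≤ C * ρ ^ (r + 1 + r * ((t + r) * l)) := h2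
      _ = C * ρ ^ (r + 1 + r * (r * l)) * (ρ ^ (r * l)) ^ t := by
          rw [← pow_mul, mul_assoc, ← pow_add]; ring_nf
  have h3 : ((r * l).factorial : ℝ) ≤ Nat.card (RowFilling r l) * (l.factorial : ℝ) ^ r := by
    exact_mod_cast factorial_le_card_rowFilling r l
  calc ((r * l).factorial : ℝ) ^ 2 ≤ (Nat.card (RowFilling r l) * (l.factorial : ℝ) ^ r) ^ 2 := by
        gcongr
    _ = (Nat.card (RowFilling r l) : ℝ) ^ 2 * ((l.factorial : ℝ) ^ r) ^ 2 := by ring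
    _ ≤ _ := by gcongr

/-! ### Nonrationality -/

theorem theorem5p3 (k : ℕ) (hk : 3 ≤ k) :
    ¬ IsRationalSeries (oneCopyGenFun (decreasingPattern k)) := by
  obtain ⟨d, rfl⟩ : ∃ d, k = d + 3 := ⟨k - 3, by omega⟩
  intro hrat
  have hcoeff : ∀ n, ‖PowerSeries.coeff n (oneCopyGenFun (decreasingPattern (d + 3)))‖ =
      numPermsWithOneCopy (decreasingPattern (d + 3)) n := fun n => by
    simp [oneCopyGenFun]
  obtain ⟨ρ, C, hρ, hρR, hle⟩ := hrat.geometric_bound (R := ((d : ℝ) + 2) ^ 2) (by positivity) (by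
    simpa only [hcoeff] using tendsto_numPermsWithOneCopy_div d)
  simp only [hcoeff] at hle
  have := sq_le_of_numPermsWithOneCopy_le (r := d + 2) (by omega) hρ hle
  push_cast at this
  linarith
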